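/- Let $\rho$ be a positive function on $(0,\infty)$ with $\rho(x)\to 0$ as $x\to\infty$. For real functions $f,g$, write $f(x)=\Omega_{\pm}(g(x))$ if there is a constant $c>0$ such that each of the inequalities $f(x)>c\,g(x)$ and $f(x)<-c\,g(x)$ holds for arbitrarily large values of $x$. (i) There is a non-decreasing function $S:[0,\infty)\to\mathbb{R}$ whose Laplace–Stieltjes transform $\mathcal{L}\{dS;s\}=\int_0^\infty e^{-sx}\,dS(x)$ converges for $\Re s>1$ and such that $\mathcal{L}\{dS;s\}-\frac{1}{s-1}$ extends from $\Re s>1$ to an entire function on $\mathbb{C}$, while $$S(x)=e^{x}+\Omega_{\pm}(\rho(x)e^{x}),$$ that is, $S(x)-e^x=\Omega_{\pm}(\rho(x)e^{x})$. (ii) There is a real-valued $C^\infty$ function $\tau$ on $(0,\infty)$ with bounded derivative whose Laplace transform $\mathcal{L}\{\tau;s\}=\int_0^\infty \tau(x)e^{-sx}\,dx$ (which converges absolutely for $\Re s>0$) extends from $\Re s>0$ to an entire function on $\mathbb{C}$, while $$\tau(x)=\Omega_{\pm}(\rho(x)).$$ -/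

import Mathlib

namespace Tauberian

open Filter MeasureTheory

/-- `f = Ω_±(g)` at infinity: there is `c > 0` such that each of the inequalities
`f x > c * g x` and `f x < -c * g x` holds for arbitrarily large `x`. -/
def IsOmegaPM (f g : ℝ → ℝ) : Prop :=
  ∃ c : ℝ, 0 < c ∧ (∃ᶠ x in atTop, c * g x < f x) ∧ (∃ᶠ x in atTop, f x < -c * g x)

/-- The constant extension to the left of `0` of a function that is non-decreasing on `[0, ∞)`
is non-decreasing on `ℝ`. -/
theorem monotone_extend {S : ℝ → ℝ} (hS : MonotoneOn S (Set.Ici 0)) :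
    Monotone (fun x : ℝ => S (max x 0)) := fun _ _ hxy =>
  hS (Set.mem_Ici.2 (le_max_right _ _)) (Set.mem_Ici.2 (le_max_right _ _))
    (max_le_max_right 0 hxy)

/-- The Lebesgue-Stieltjes measure `dS` of a function `S` that is non-decreasing on `[0, ∞)`.
Only the values of `S` on `[0, ∞)` enter; `S` is extended by the constant `S 0` to the left of `0`,
so that `dS` is carried by `[0, ∞)`, with mass `S (0+) - S 0` at `0`. -/
noncomputable def stieltjesMeasure (S : ℝ → ℝ) (hS : MonotoneOn S (Set.Ici 0)) : Measure ℝ :=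
  (monotone_extend hS).stieltjesFunction.measure

/-- Convergence of the Laplace-Stieltjes integral `∫_0^∞ e^{-sx} dS(x)`. As `dS` is a positive
measure, convergence on an open half-plane is the same as absolute convergence there. -/
def LaplaceStieltjesConverges (S : ℝ → ℝ) (hS : MonotoneOn S (Set.Ici 0)) (s : ℂ) : Prop :=
  IntegrableOn (fun x : ℝ => Complex.exp (-s * (x : ℂ))) (Set.Ici 0) (stieltjesMeasure S hS)

/-- The Laplace-Stieltjes transform `∫_0^∞ e^{-sx} dS(x)`. -/
noncomputable def laplaceStieltjes (S : ℝ → ℝ) (hS : MonotoneOn S (Set.Ici 0)) (s : ℂ) : ℂ :=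
  ∫ x in Set.Ici (0 : ℝ), Complex.exp (-s * (x : ℂ)) ∂(stieltjesMeasure S hS)

/-- Absolute convergence of the Laplace integral `∫_0^∞ τ(x) e^{-sx} dx`. -/
def LaplaceConverges (τ : ℝ → ℝ) (s : ℂ) : Prop :=
  IntegrableOn (fun x : ℝ => (τ x : ℂ) * Complex.exp (-s * (x : ℂ))) (Set.Ioi 0)

/-- The Laplace transform `∫_0^∞ τ(x) e^{-sx} dx`. -/
noncomputable def laplace (τ : ℝ → ℝ) (s : ℂ) : ℂ :=
  ∫ x in Set.Ioi (0 : ℝ), (τ x : ℂ) * Complex.exp (-s * (x : ℂ))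

end Tauberian

/-!
The obstruction to any remainder is a function `τ` on the line that is a lacunary sum of wave
packets
`τ x = ∑ (-1/4)ⁿ exp (-(l/X) (x - X)²) cos (l (x - X))`, with `l = n + 1` and `X = X n`.

*Entire Laplace transform.* Up to a bounded left tail, the Laplace transform of one packet is an
explicit Gaussian integral of order `exp (-s X) exp ((s ± i l)² X / (4 l))`. For `s` in a fixed disc
this is `exp (X (O(1) - l / 4))`, which is bounded as soon as `l` is large, *however large `X` is*
(`norm_laplacePacket_le`). So the sum of the transforms converges locally uniformly on `ℂ`, with no
relation required between the amplitudes, or the frequencies, and the centres. This is where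
analyticity of the packets matters: a width of order `√(X / l)` makes a packet decay exponentially
in `l X`, both at the origin and in frequency.

*Oscillation.* The centres may therefore be taken so far out that `ρ (X n) ≤ 4⁻ⁿ`, and so sparse
that the `n`-th term dominates the sum at `X n` (`abs_packetSeries_center_sub_le`). The alternating
signs give `Ω_±`. Boundedness of `τ` and `τ'` is immediate from the decay of the amplitudes, and
`τ` is smooth because the series converges to an entire function of a complex variable.

*Monotone functions.* For small `c > 0` the function `S x = exp x * (1 + c τ x)` is non-decreasing,
and integration by parts turns its Laplace–Stieltjes transform into
`1 / (s - 1) + s c 𝓛τ (s - 1) - c τ 0` (`exists_monotone_laplaceStieltjes_entire`).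
-/

namespace Tauberian

open Filter MeasureTheory Topology

/-! ### Wave packets -/

/-- The wave packet of frequency `l` centred at `X`: a cosine under a Gaussian whose variance is
of order `X / l`, as a function of a complex variable. -/
noncomputable def wavePacket (l X : ℝ) (z : ℂ) : ℂ :=
  Complex.exp (-((l / X : ℝ) : ℂ) * (z - X) ^ 2) * Complex.cos (l * (z - X))

/-- The restriction of `wavePacket` to the real line. -/
noncomputable def realWavePacket (l X x : ℝ) : ℝ :=
  Real.exp (-(l / X) * (x - X) ^ 2) * Real.cos (l * (x - X))

theorem ofReal_realWavePacket (l X x : ℝ) :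
    ((realWavePacket l X x : ℝ) : ℂ) = wavePacket l X x := by
  simp [realWavePacket, wavePacket]

theorem differentiable_wavePacket (l X : ℝ) : Differentiable ℂ (wavePacket l X) := by
  unfold wavePacket
  fun_prop

theorem realWavePacket_self (l X : ℝ) : realWavePacket l X X = 1 := by
  simp [realWavePacket]

theorem abs_realWavePacket_le (l X x : ℝ) :
    |realWavePacket l X x| ≤ Real.exp (-(l / X) * (x - X) ^ 2) := by
  rw [realWavePacket, abs_mul, Real.abs_exp]
  exact mul_le_of_le_one_right (Real.exp_pos _).le (Real.abs_cos_le_one _)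

theorem abs_realWavePacket_le_one {l X : ℝ} (hl : 0 ≤ l) (hX : 0 ≤ X) (x : ℝ) :
    |realWavePacket l X x| ≤ 1 := by
  refine (abs_realWavePacket_le l X x).trans (Real.exp_le_one_iff.2 ?_)
  have : 0 ≤ l / X * (x - X) ^ 2 := by positivity
  linarith

theorem continuous_realWavePacket (l X : ℝ) : Continuous (realWavePacket l X) := by
  unfold realWavePacket
  fun_prop

theorem hasDerivAt_realWavePacket (l X x : ℝ) :
    HasDerivAt (realWavePacket l X)
      (Real.exp (-(l / X) * (x - X) ^ 2) * (-(l / X) * (2 * (x - X))) * Real.cos (l * (x - X))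
        + Real.exp (-(l / X) * (x - X) ^ 2) * (-Real.sin (l * (x - X)) * l)) x := by
  have h1 : HasDerivAt (fun y : ℝ => -(l / X) * (y - X) ^ 2) (-(l / X) * (2 * (x - X))) x := by
    have := (((hasDerivAt_id x).sub_const X).pow 2).const_mul (-(l / X))
    simpa using this
  have h2 : HasDerivAt (fun y : ℝ => l * (y - X)) l x := by
    simpa using ((hasDerivAt_id x).sub_const X).const_mul l
  exact h1.exp.mul h2.cos

theorem abs_deriv_realWavePacket_le {l X : ℝ} (hl : 0 ≤ l) (hX : 1 ≤ X) (x : ℝ) :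
    |deriv (realWavePacket l X) x| ≤ 2 * l + 1 := by
  rw [(hasDerivAt_realWavePacket l X x).deriv]
  have hb0 : 0 ≤ l / X := by positivity
  have hbl : l / X ≤ l := div_le_self hl hX
  set b := l / X
  set u := x - X
  have hE : Real.exp (-b * u ^ 2) ≤ 1 := Real.exp_le_one_iff.2 (by nlinarith [sq_nonneg u])
  have hE0 := Real.exp_pos (-b * u ^ 2)
  -- `2 b |u| ≤ b + b u ^ 2`, and `b u ^ 2 * exp (-b u ^ 2) ≤ 1`
  have hmul : Real.exp (-b * u ^ 2) * (b * u ^ 2) ≤ 1 := by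
    have h := Real.add_one_le_exp (b * u ^ 2)
    calc Real.exp (-b * u ^ 2) * (b * u ^ 2)
        ≤ Real.exp (-b * u ^ 2) * Real.exp (b * u ^ 2) := by gcongr; linarith
      _ = 1 := by rw [← Real.exp_add]; simp
  have hu : 2 * |u| ≤ 1 + u ^ 2 := by nlinarith [sq_nonneg (|u| - 1), sq_abs u]
  have hA : |Real.exp (-b * u ^ 2) * (-b * (2 * u)) * Real.cos (l * u)| ≤ b + 1 := by
    calc |Real.exp (-b * u ^ 2) * (-b * (2 * u)) * Real.cos (l * u)|
        = Real.exp (-b * u ^ 2) * (b * (2 * |u|)) * |Real.cos (l * u)| := by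
          simp [abs_mul, abs_of_nonneg hb0]
      _ ≤ Real.exp (-b * u ^ 2) * (b * (1 + u ^ 2)) * 1 := by
          gcongr
          exact Real.abs_cos_le_one _
      _ ≤ b + 1 := by nlinarith
  have hB : |Real.exp (-b * u ^ 2) * (-Real.sin (l * u) * l)| ≤ l := by
    calc |Real.exp (-b * u ^ 2) * (-Real.sin (l * u) * l)|
        = Real.exp (-b * u ^ 2) * (|Real.sin (l * u)| * l) := by
          simp [abs_mul, abs_of_nonneg hl]
      _ ≤ 1 * (1 * l) := by
          gcongr
          exact Real.abs_sin_le_one _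
      _ = l := by ring
  linarith [abs_add_le (Real.exp (-b * u ^ 2) * (-b * (2 * u)) * Real.cos (l * u))
    (Real.exp (-b * u ^ 2) * (-Real.sin (l * u) * l))]

theorem norm_cos_le_exp_abs_im (w : ℂ) : ‖Complex.cos w‖ ≤ Real.exp |w.im| := by
  rw [Complex.cos, norm_div, Complex.norm_two]
  have h1 : ‖Complex.exp (w * Complex.I)‖ ≤ Real.exp |w.im| := by
    rw [Complex.norm_exp]
    simpa using neg_le_abs w.im
  have h2 : ‖Complex.exp (-w * Complex.I)‖ ≤ Real.exp |w.im| := by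
    rw [Complex.norm_exp]
    simpa using le_abs_self w.im
  linarith [norm_add_le (Complex.exp (w * Complex.I)) (Complex.exp (-w * Complex.I))]

/-- On a fixed complex disc, a packet centred far enough to the right is bounded by `1`, whatever
its frequency: the growth of the cosine is of order `exp (l K)`, the Gaussian of order
`exp (-l X)`. -/
theorem norm_wavePacket_le_one {l X K : ℝ} (hl : 0 ≤ l) (hX : 1 ≤ X)
    (hXK : 3 * K + K ^ 2 ≤ X) {z : ℂ} (hz : ‖z‖ ≤ K) : ‖wavePacket l X z‖ ≤ 1 := by
  have hX0 : 0 < X := by linarith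
  have hre : |z.re| ≤ K := (Complex.abs_re_le_norm z).trans hz
  have him : |z.im| ≤ K := (Complex.abs_im_le_norm z).trans hz
  have hcos : ‖Complex.cos (l * (z - X))‖ ≤ Real.exp (l * K) := by
    refine (norm_cos_le_exp_abs_im _).trans (Real.exp_le_exp.2 ?_)
    have : ((l : ℂ) * (z - X)).im = l * z.im := by simp
    rw [this, abs_mul, abs_of_nonneg hl]
    gcongr
  have hre2 : (-((l / X : ℝ) : ℂ) * (z - X) ^ 2).re
      = l / X * (z.im ^ 2 - (z.re - X) ^ 2) := by
    rw [← Complex.ofReal_neg, Complex.re_ofReal_mul]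
    simp only [pow_two, Complex.mul_re, Complex.sub_re, Complex.sub_im, Complex.ofReal_re,
      Complex.ofReal_im]
    ring
  have hexp : ‖Complex.exp (-((l / X : ℝ) : ℂ) * (z - X) ^ 2)‖
      ≤ Real.exp (l * (2 * K + K ^ 2 - X)) := by
    rw [Complex.norm_exp, hre2]
    refine Real.exp_le_exp.2 ?_
    have h1 : z.im ^ 2 - (z.re - X) ^ 2 ≤ X * (2 * K + K ^ 2 - X) := by
      have := abs_le.1 hre
      have : z.im ^ 2 ≤ K ^ 2 := by
        rw [← sq_abs]; gcongr
      nlinarith [sq_nonneg z.re, sq_nonneg K]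
    calc l / X * (z.im ^ 2 - (z.re - X) ^ 2) ≤ l / X * (X * (2 * K + K ^ 2 - X)) := by gcongr
      _ = l * (2 * K + K ^ 2 - X) := by field_simp
  rw [wavePacket, norm_mul]
  calc _ ≤ Real.exp (l * (2 * K + K ^ 2 - X)) * Real.exp (l * K) := by gcongr
    _ = Real.exp (l * (3 * K + K ^ 2 - X)) := by rw [← Real.exp_add]; ring_nf
    _ ≤ 1 := Real.exp_le_one_iff.2 (mul_nonpos_of_nonneg_of_nonpos hl (by linarith))

/-! ### Laplace transforms of wave packets -/

theorem integrable_exp_neg_mul_sub_sq_add_mul {b : ℝ} (hb : 0 < b) (a c : ℝ) :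
    Integrable (fun x : ℝ => Real.exp (-b * (x - a) ^ 2 + c * x)) := by
  have h := (integrable_cexp_quadratic' (b := ((-b : ℝ) : ℂ)) (by simpa using hb)
    ((2 * b * a + c : ℝ) : ℂ) ((-b * a ^ 2 : ℝ) : ℂ)).norm
  refine h.congr (Eventually.of_forall fun x => ?_)
  simp only [Complex.norm_exp]
  norm_cast
  ring_nf

theorem norm_mul_exp_neg_mul_le {h : ℝ → ℂ} {b a : ℝ}
    (hh : ∀ x, ‖h x‖ ≤ Real.exp (-b * (x - a) ^ 2)) (s : ℂ) (x : ℝ) :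
    ‖h x * Complex.exp (-s * x)‖ ≤ Real.exp (-b * (x - a) ^ 2 + -s.re * x) := by
  rw [norm_mul, Complex.norm_exp, Real.exp_add]
  have : (-s * (x : ℂ)).re = -s.re * x := by simp
  rw [this]
  gcongr
  exact hh x

theorem integrable_mul_exp_neg_mul {h : ℝ → ℂ} {b a : ℝ} (hc : Continuous h) (hb : 0 < b)
    (hh : ∀ x, ‖h x‖ ≤ Real.exp (-b * (x - a) ^ 2)) (s : ℂ) :
    Integrable (fun x : ℝ => h x * Complex.exp (-s * x)) :=
  (integrable_exp_neg_mul_sub_sq_add_mul hb a (-s.re)).mono' (by fun_prop)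
    (Eventually.of_forall fun x => norm_mul_exp_neg_mul_le hh s x)

/-- The one-sided Laplace transform of a function with Gaussian decay is entire. -/
theorem differentiable_integral_mul_exp_neg_mul {h : ℝ → ℂ} {b a : ℝ} (hc : Continuous h)
    (hb : 0 < b) (hh : ∀ x, ‖h x‖ ≤ Real.exp (-b * (x - a) ^ 2)) :
    Differentiable ℂ (fun s : ℂ => ∫ x in Set.Ioi (0 : ℝ), h x * Complex.exp (-s * x)) := by
  intro s₀
  have key := hasDerivAt_integral_of_dominated_loc_of_deriv_le
    (μ := volume.restrict (Set.Ioi (0 : ℝ))) (s := Metric.ball s₀ 1) (x₀ := s₀)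
    (F := fun (s : ℂ) (x : ℝ) => h x * Complex.exp (-s * x))
    (F' := fun (s : ℂ) (x : ℝ) => h x * (Complex.exp (-s * x) * (-x)))
    (bound := fun x : ℝ => Real.exp (-b * (x - a) ^ 2 + (2 - s₀.re) * x))
    (Metric.ball_mem_nhds s₀ one_pos)
    (Eventually.of_forall fun s => (integrable_mul_exp_neg_mul hc hb hh s).integrableOn.1)
    (integrable_mul_exp_neg_mul hc hb hh s₀).integrableOn
    (by fun_prop) ?_ (integrable_exp_neg_mul_sub_sq_add_mul hb a _).integrableOn ?_
  · exact key.2.differentiableAt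
  · refine (ae_restrict_iff' measurableSet_Ioi).2 (Eventually.of_forall fun x hx s hs => ?_)
    have hx : 0 < x := hx
    have hs' : s₀.re - s.re ≤ 1 := by
      have := (Complex.abs_re_le_norm (s₀ - s)).trans
        ((by rw [← dist_eq_norm, dist_comm]; exact (Metric.mem_ball.1 hs).le) : ‖s₀ - s‖ ≤ 1)
      simpa using (abs_le.1 this).2
    have hxe : ‖(-x : ℂ)‖ ≤ Real.exp x := by
      rw [norm_neg, Complex.norm_real, Real.norm_of_nonneg hx.le]
      linarith [Real.add_one_le_exp x]
    rw [← mul_assoc, norm_mul]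
    calc _ ≤ Real.exp (-b * (x - a) ^ 2 + -s.re * x) * Real.exp x := by
          gcongr
          exact norm_mul_exp_neg_mul_le hh s x
      _ = Real.exp (-b * (x - a) ^ 2 + (1 - s.re) * x) := by rw [← Real.exp_add]; ring_nf
      _ ≤ _ := Real.exp_le_exp.2 (by nlinarith)
  · refine Eventually.of_forall fun x s _ => ?_
    have h1 : HasDerivAt (fun s : ℂ => -s * (x : ℂ)) (-x) s := by
      simpa using (hasDerivAt_id s).neg.mul_const (x : ℂ)
    exact h1.cexp.const_mul (h x)

theorem norm_wavePacket_ofReal_le (l X x : ℝ) :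
    ‖wavePacket l X x‖ ≤ Real.exp (-(l / X) * (x - X) ^ 2) := by
  rw [← ofReal_realWavePacket, Complex.norm_real]
  exact abs_realWavePacket_le l X x

/-- The left tail of the two-sided Laplace integral of a packet of high frequency is bounded: on
`x ≤ 0` the Gaussian is at most `exp (2 l x)`. -/
theorem norm_integral_Iic_wavePacket_le_one {l X K : ℝ} (hl : K + 1 ≤ 2 * l) (hl0 : 0 ≤ l)
    (hX : 0 < X) {s : ℂ} (hs : ‖s‖ ≤ K) :
    ‖∫ x in Set.Iic (0 : ℝ), wavePacket l X x * Complex.exp (-s * x)‖ ≤ 1 := by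
  rw [← integral_exp_Iic_zero]
  refine norm_integral_le_of_norm_le (integrableOn_exp_Iic 0)
    ((ae_restrict_iff' measurableSet_Iic).2 (Eventually.of_forall fun x hx => ?_))
  have hx : x ≤ 0 := hx
  refine (norm_mul_exp_neg_mul_le (norm_wavePacket_ofReal_le l X) s x).trans
    (Real.exp_le_exp.2 ?_)
  have hre := abs_le.1 ((Complex.abs_re_le_norm s).trans hs)
  have h1 : l / X * (-2 * x * X) ≤ l / X * (x - X) ^ 2 := by
    gcongr
    nlinarith [sq_nonneg x, sq_nonneg X]
  have h2 : l / X * (-2 * x * X) = -2 * l * x := by field_simp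
  nlinarith

/-- The two-sided Laplace integral of one of the two exponentials (`σ = ± 1`) that make up a
packet. By the explicit formula it is of order `exp (X (O(1) - l / 4))`: the decay of the Gaussian
in the frequency beats the factor `exp (-s X)` as soon as `l` exceeds a constant depending on `s`
only. -/
theorem norm_integral_cexp_le {l X K σ : ℝ} (hl : 6 * K + K ^ 2 + 4 ≤ l) (hK : 0 ≤ K)
    (hX : 1 ≤ X) (hσ : σ = 1 ∨ σ = -1) {s : ℂ} (hs : ‖s‖ ≤ K) :
    ‖∫ x : ℝ, Complex.exp (-((l / X : ℝ) : ℂ) * (x - X) ^ 2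
      + σ * l * (x - X) * Complex.I - s * x)‖ ≤ 4 := by
  have hl0 : 0 < l := by nlinarith
  have hX0 : 0 < X := by linarith
  have hb : 0 < l / X := by positivity
  have hform : ∀ x : ℝ, -((l / X : ℝ) : ℂ) * (x - X) ^ 2 + σ * l * (x - X) * Complex.I - s * x
      = ((-(l / X) : ℝ) : ℂ) * (x : ℂ) ^ 2 + (2 * l + σ * l * Complex.I - s) * x
        + (-(l * X) - σ * l * X * Complex.I) := by
    intro x
    have : (X : ℂ) ≠ 0 := by exact_mod_cast hX0.ne'
    push_cast
    field_simp
    ring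
  simp_rw [hform]
  rw [integral_cexp_quadratic (by simpa using hb), norm_mul]
  have hsqrt : ‖((Real.pi : ℂ) / -((-(l / X) : ℝ) : ℂ)) ^ (1 / 2 : ℂ)‖ ≤ 4 * X := by
    have h1 : (Real.pi : ℂ) / -((-(l / X) : ℝ) : ℂ) = ((Real.pi / (l / X) : ℝ) : ℂ) := by
      push_cast; ring
    have hpos : 0 < Real.pi / (l / X) := by positivity
    rw [h1, Complex.norm_cpow_eq_rpow_re_of_pos hpos]
    have h2 : (1 / 2 : ℂ).re = 1 / 2 := by norm_num
    rw [h2, ← Real.sqrt_eq_rpow, Real.sqrt_le_left (by positivity)]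
    calc Real.pi / (l / X) = Real.pi * X / l := by field_simp
      _ ≤ 4 * X / 1 := by
        gcongr
        · exact Real.pi_le_four
        · nlinarith
      _ ≤ (4 * X) ^ 2 := by nlinarith
  have hre : ((-(l * X) - σ * l * X * Complex.I : ℂ)
      - (2 * l + σ * l * Complex.I - s) ^ 2 / (4 * ((-(l / X) : ℝ) : ℂ))).re ≤ -X := by
    have h3 : (2 * l + σ * l * Complex.I - s) ^ 2 / (4 * ((-(l / X) : ℝ) : ℂ))
        = ((-(X / (4 * l)) : ℝ) : ℂ) * (2 * l + σ * l * Complex.I - s) ^ 2 := by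
      have : (X : ℂ) ≠ 0 := by exact_mod_cast hX0.ne'
      have : (l : ℂ) ≠ 0 := by exact_mod_cast hl0.ne'
      push_cast
      field_simp
    rw [h3, Complex.sub_re, Complex.re_ofReal_mul]
    have h4 : (-(l * X) - σ * l * X * Complex.I : ℂ).re = -(l * X) := by simp
    have h5 : ((2 * l + σ * l * Complex.I - s) ^ 2 : ℂ).re
        = (2 * l - s.re) ^ 2 - (σ * l - s.im) ^ 2 := by
      simp [pow_two]
    rw [h4, h5]
    have hr := abs_le.1 ((Complex.abs_re_le_norm s).trans hs)
    have hi := abs_le.1 ((Complex.abs_im_le_norm s).trans hs)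
    have h6 : (2 * l - s.re) ^ 2 - (σ * l - s.im) ^ 2 ≤ 4 * l * l - 4 * l := by
      have hr2 : s.re ^ 2 ≤ K ^ 2 := sq_le_sq' hr.1 hr.2
      have hσ2 : σ ^ 2 = 1 := by rcases hσ with rfl | rfl <;> norm_num
      have h7 : σ * s.im ≤ K := by rcases hσ with rfl | rfl <;> linarith
      have h8 : (σ * l - s.im) ^ 2 = l ^ 2 - 2 * l * (σ * s.im) + s.im ^ 2 := by
        linear_combination l ^ 2 * hσ2
      nlinarith [sq_nonneg s.im, mul_le_mul_of_nonneg_left h7 hl0.le,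
        mul_le_mul_of_nonneg_left hr.1 hl0.le, mul_le_mul_of_nonneg_left hl hl0.le,
        sq_nonneg K]
    have h9 : X / (4 * l) * ((2 * l - s.re) ^ 2 - (σ * l - s.im) ^ 2)
        ≤ X / (4 * l) * (4 * l * l - 4 * l) := by gcongr
    have h10 : X / (4 * l) * (4 * l * l - 4 * l) = l * X - X := by field_simp
    linarith
  rw [Complex.norm_exp]
  calc _ ≤ 4 * X * Real.exp (-X) := by gcongr
    _ ≤ 4 * Real.exp X * Real.exp (-X) := by
        gcongr
        linarith [Real.add_one_le_exp X]
    _ = 4 := by rw [mul_assoc, ← Real.exp_add]; simp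

theorem continuous_wavePacket_ofReal (l X : ℝ) : Continuous (fun x : ℝ => wavePacket l X x) :=
  (differentiable_wavePacket l X).continuous.comp Complex.continuous_ofReal

theorem norm_integral_wavePacket_le {l X K : ℝ} (hl : 6 * K + K ^ 2 + 4 ≤ l) (hK : 0 ≤ K)
    (hX : 1 ≤ X) {s : ℂ} (hs : ‖s‖ ≤ K) :
    ‖∫ x : ℝ, wavePacket l X x * Complex.exp (-s * x)‖ ≤ 4 := by
  have hb : 0 < l / X := div_pos (by nlinarith) (by linarith)
  have hint : ∀ σ : ℝ, Integrable fun x : ℝ => Complex.exp (-((l / X : ℝ) : ℂ) * (x - X) ^ 2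
      + σ * l * (x - X) * Complex.I - s * x) := by
    intro σ
    refine (integrable_mul_exp_neg_mul (b := l / X) (a := X) (h := fun x : ℝ =>
      Complex.exp (-((l / X : ℝ) : ℂ) * (x - X) ^ 2 + σ * l * (x - X) * Complex.I))
      (by fun_prop) hb (fun x => ?_) s).congr (Eventually.of_forall fun x => ?_)
    · rw [Complex.norm_exp]
      have : (-((l / X : ℝ) : ℂ) * (x - X) ^ 2 + σ * l * (x - X) * Complex.I)
          = ((-(l / X) * (x - X) ^ 2 : ℝ) : ℂ) + ((σ * l * (x - X) : ℝ) : ℂ) * Complex.I := by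
        push_cast; ring
      rw [this]
      simp only [Complex.add_re, Complex.ofReal_re, Complex.re_ofReal_mul, Complex.I_re]
      simp
    · simp only [← Complex.exp_add]
      ring_nf
  have hsplit : ∀ x : ℝ, wavePacket l X x * Complex.exp (-s * x)
      = (Complex.exp (-((l / X : ℝ) : ℂ) * (x - X) ^ 2
          + (1 : ℝ) * l * (x - X) * Complex.I - s * x)
        + Complex.exp (-((l / X : ℝ) : ℂ) * (x - X) ^ 2
          + (-1 : ℝ) * l * (x - X) * Complex.I - s * x)) / 2 := by
    intro x
    rw [wavePacket, Complex.cos, sub_eq_add_neg _ (s * (x : ℂ)), sub_eq_add_neg _ (s * (x : ℂ))]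
    simp only [Complex.exp_add]
    push_cast
    ring_nf
  simp_rw [hsplit]
  rw [integral_div, integral_add (hint 1) (hint (-1)), norm_div, Complex.norm_two]
  have h1 := norm_integral_cexp_le hl hK hX (Or.inl rfl) hs
  have h2 := norm_integral_cexp_le hl hK hX (Or.inr rfl) hs
  linarith [norm_add_le _ _ |>.trans (add_le_add h1 h2)]

/-- The Laplace transform of a single packet. -/
noncomputable def laplacePacket (l X : ℝ) (s : ℂ) : ℂ :=
  ∫ x in Set.Ioi (0 : ℝ), wavePacket l X x * Complex.exp (-s * x)

theorem differentiable_laplacePacket {l X : ℝ} (hl : 0 < l) (hX : 0 < X) :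
    Differentiable ℂ (laplacePacket l X) :=
  differentiable_integral_mul_exp_neg_mul (continuous_wavePacket_ofReal l X) (div_pos hl hX)
    (norm_wavePacket_ofReal_le l X)

/-- On a fixed disc, the Laplace transforms of all packets of sufficiently high frequency are
bounded by the same constant, wherever the packets are centred. -/
theorem norm_laplacePacket_le {l X K : ℝ} (hl : 6 * K + K ^ 2 + 4 ≤ l) (hK : 0 ≤ K)
    (hX : 1 ≤ X) {s : ℂ} (hs : ‖s‖ ≤ K) : ‖laplacePacket l X s‖ ≤ 5 := by
  have hl0 : 0 < l := by nlinarith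
  have hint := integrable_mul_exp_neg_mul (continuous_wavePacket_ofReal l X)
    (div_pos hl0 (by linarith : 0 < X)) (norm_wavePacket_ofReal_le l X) s
  have hsplit : laplacePacket l X s = (∫ x : ℝ, wavePacket l X x * Complex.exp (-s * x))
      - ∫ x in Set.Iic (0 : ℝ), wavePacket l X x * Complex.exp (-s * x) := by
    rw [laplacePacket, ← Set.compl_Iic, ← integral_add_compl measurableSet_Iic hint]
    ring
  rw [hsplit]
  have h1 := norm_integral_wavePacket_le hl hK hX hs
  have h2 := norm_integral_Iic_wavePacket_le_one (l := l) (by nlinarith) hl0.le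
    (by linarith : 0 < X) hs
  linarith [norm_sub_le (∫ x : ℝ, wavePacket l X x * Complex.exp (-s * x))
    (∫ x in Set.Iic (0 : ℝ), wavePacket l X x * Complex.exp (-s * x))]

/-! ### The lacunary series of packets -/

/-- The series of packets of frequency `n + 1` and amplitude `4⁻ⁿ` centred at `X n`, with
alternating signs. -/
noncomputable def packetSeries (X : ℕ → ℝ) (x : ℝ) : ℝ :=
  ∑' n : ℕ, (-1 / 4) ^ n * realWavePacket (n + 1) (X n) x

theorem summable_quarter_pow : Summable fun n : ℕ => (1 / 4 : ℝ) ^ n :=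
  summable_geometric_of_lt_one (by norm_num) (by norm_num)

theorem tsum_quarter_pow : ∑' n : ℕ, (1 / 4 : ℝ) ^ n = 4 / 3 := by
  rw [tsum_geometric_of_lt_one (by norm_num) (by norm_num)]
  norm_num

theorem abs_neg_quarter_pow (n : ℕ) : |(-1 / 4 : ℝ) ^ n| = (1 / 4) ^ n := by
  rw [abs_pow]
  norm_num [abs_div]

theorem norm_neg_quarter_pow (n : ℕ) : ‖(-1 / 4 : ℂ) ^ n‖ = (1 / 4) ^ n := by
  rw [norm_pow]
  norm_num

theorem abs_packetTerm_le {X : ℕ → ℝ} (hX : ∀ n, 1 ≤ X n) (n : ℕ) (x : ℝ) :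
    |(-1 / 4) ^ n * realWavePacket (n + 1) (X n) x| ≤ (1 / 4) ^ n := by
  rw [abs_mul, abs_neg_quarter_pow]
  exact mul_le_of_le_one_right (by positivity)
    (abs_realWavePacket_le_one (by positivity) (by linarith [hX n]) x)

theorem summable_packetTerm {X : ℕ → ℝ} (hX : ∀ n, 1 ≤ X n) (x : ℝ) :
    Summable fun n : ℕ => (-1 / 4) ^ n * realWavePacket (n + 1) (X n) x :=
  .of_norm_bounded summable_quarter_pow fun n => abs_packetTerm_le hX n x

theorem abs_packetSeries_le {X : ℕ → ℝ} (hX : ∀ n, 1 ≤ X n) (x : ℝ) :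
    |packetSeries X x| ≤ 4 / 3 := by
  rw [← tsum_quarter_pow, packetSeries, ← Real.norm_eq_abs]
  exact tsum_of_norm_bounded summable_quarter_pow.hasSum fun n => abs_packetTerm_le hX n x

theorem exists_abs_deriv_packetSeries_le {X : ℕ → ℝ} (hX : ∀ n, 1 ≤ X n) :
    ∃ C, ∀ x, |deriv (packetSeries X) x| ≤ C := by
  have hu : Summable fun n : ℕ => (1 / 4 : ℝ) ^ n * (2 * (n + 1) + 1) := by
    have h1 := (summable_pow_mul_geometric_of_norm_lt_one (R := ℝ) 1 (r := 1 / 4)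
      (by norm_num)).mul_left 2
    refine (h1.add (summable_quarter_pow.mul_left 3)).congr fun n => ?_
    ring
  have hd : ∀ (n : ℕ) (y : ℝ), HasDerivAt
      (fun x => (-1 / 4) ^ n * realWavePacket (n + 1) (X n) x)
      ((-1 / 4) ^ n * deriv (realWavePacket (n + 1) (X n)) y) y := fun n y =>
    (hasDerivAt_realWavePacket (n + 1) (X n) y).differentiableAt.hasDerivAt.const_mul _
  have hb : ∀ (n : ℕ) (y : ℝ), ‖(-1 / 4) ^ n * deriv (realWavePacket (n + 1) (X n)) y‖
      ≤ (1 / 4 : ℝ) ^ n * (2 * (n + 1) + 1) := by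
    intro n y
    rw [Real.norm_eq_abs, abs_mul, abs_neg_quarter_pow]
    gcongr
    exact abs_deriv_realWavePacket_le (by positivity) (hX n) y
  refine ⟨∑' n : ℕ, (1 / 4 : ℝ) ^ n * (2 * (n + 1) + 1), fun x => ?_⟩
  have hx : HasDerivAt (packetSeries X) _ x :=
    hasDerivAt_tsum hu hd hb (summable_packetTerm hX 0) x
  rw [hx.deriv]
  exact tsum_of_norm_bounded hu.hasSum fun n => hb n x

/-- A series of entire functions is entire if, on every disc, its terms are eventually dominated by
those of a fixed summable series. -/
theorem differentiable_tsum_of_eventually_norm_le {f : ℕ → ℂ → ℂ} {u : ℕ → ℝ} (hu : Summable u)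
    (hf : ∀ n, Differentiable ℂ (f n))
    (hfu : ∀ K : ℝ, 0 ≤ K → ∀ᶠ n in atTop, ∀ z : ℂ, ‖z‖ ≤ K → ‖f n z‖ ≤ u n) :
    Differentiable ℂ fun z => ∑' n, f n z := by
  intro z₀
  have hz₀ : z₀ ∈ Metric.ball (0 : ℂ) (‖z₀‖ + 1) := by simp
  have hlim := (tendstoUniformlyOn_tsum_nat_eventually hu (f := f)
    (s := Metric.ball (0 : ℂ) (‖z₀‖ + 1)) ((hfu (‖z₀‖ + 1) (by positivity)).mono
      fun n hn z hz => hn z (mem_ball_zero_iff.1 hz).le)).tendstoLocallyUniformlyOn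
  exact (hlim.differentiableOn (Eventually.of_forall fun N =>
    DifferentiableOn.fun_sum fun n _ => (hf n).differentiableOn) Metric.isOpen_ball).differentiableAt
      (Metric.isOpen_ball.mem_nhds hz₀)

theorem contDiff_packetSeries {X : ℕ → ℝ} (hX : ∀ n, 1 ≤ X n) (hX_lim : Tendsto X atTop atTop) :
    ContDiff ℝ ((⊤ : ℕ∞) : WithTop ℕ∞) (packetSeries X) := by
  have hd : Differentiable ℂ fun z : ℂ =>
      ∑' n : ℕ, (-1 / 4 : ℂ) ^ n * wavePacket (n + 1) (X n) z := by
    refine differentiable_tsum_of_eventually_norm_le summable_quarter_pow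
      (fun n => (differentiable_wavePacket _ _).const_mul _) fun K hK => ?_
    filter_upwards [hX_lim.eventually_ge_atTop (3 * K + K ^ 2)] with n hn z hz
    rw [norm_mul, norm_neg_quarter_pow]
    exact mul_le_of_le_one_right (by positivity)
      (norm_wavePacket_le_one (by positivity) (hX n) hn hz)
  have hc : ContDiff ℝ ((⊤ : ℕ∞) : WithTop ℕ∞) fun x : ℝ => (∑' n : ℕ, (-1 / 4 : ℂ) ^ n
      * wavePacket (n + 1) (X n) (x : ℂ)).re :=
    Complex.reCLM.contDiff.comp ((hd.contDiff.restrict_scalars ℝ).comp Complex.ofRealCLM.contDiff)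
  convert hc using 2 with x
  rw [← Complex.ofReal_re (packetSeries X x), packetSeries, Complex.ofReal_tsum]
  congr 2 with n
  rw [← ofReal_realWavePacket]
  push_cast
  rfl

theorem laplaceConverges_of_bounded {τ : ℝ → ℝ} (hc : Continuous τ) {C : ℝ} (hC : ∀ x, |τ x| ≤ C)
    {s : ℂ} (hs : 0 < s.re) : LaplaceConverges τ s := by
  refine Integrable.bdd_mul (c := C) (integrableOn_exp_mul_complex_Ioi (a := -s) (by simpa) 0)
    (by fun_prop) (Eventually.of_forall fun x => ?_)
  rw [Complex.norm_real]
  exact hC x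

/-- The Laplace transform of the series extends to the entire function obtained by summing the
Laplace transforms of the packets. -/
theorem exists_entire_eq_laplace_packetSeries {X : ℕ → ℝ} (hX : ∀ n, 1 ≤ X n) :
    ∃ G : ℂ → ℂ, Differentiable ℂ G ∧
      ∀ s : ℂ, 0 < s.re → G s = laplace (packetSeries X) s := by
  refine ⟨fun s => ∑' n : ℕ, (-1 / 4 : ℂ) ^ n * laplacePacket (n + 1) (X n) s, ?_, fun s hs => ?_⟩
  · refine differentiable_tsum_of_eventually_norm_le (summable_quarter_pow.mul_right 5)
      (fun n => (differentiable_laplacePacket (by positivity)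
        (by linarith [hX n])).const_mul _) fun K hK => ?_
    filter_upwards [tendsto_natCast_atTop_atTop.eventually_ge_atTop (6 * K + K ^ 2 + 4)]
      with n hn z hz
    rw [norm_mul, norm_neg_quarter_pow]
    gcongr
    exact norm_laplacePacket_le (by linarith) hK (hX n) hz
  · have hexp := integrableOn_exp_mul_complex_Ioi (a := -s) (by simpa) 0
    have hint : ∀ n : ℕ, IntegrableOn (fun x : ℝ => (((-1 / 4) ^ n
        * realWavePacket (n + 1) (X n) x : ℝ) : ℂ) * Complex.exp (-s * x)) (Set.Ioi 0) := fun n =>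
      laplaceConverges_of_bounded ((continuous_realWavePacket _ _).const_mul _)
        (abs_packetTerm_le hX n) hs
    have hsum := hasSum_integral_of_summable_integral_norm hint ?_
    · rw [laplace, ← show _ = _ from (hsum.tsum_eq.trans (integral_congr_ae
        (Eventually.of_forall fun x => ?_)))]
      · refine tsum_congr fun n => ?_
        rw [laplacePacket, ← integral_const_mul]
        refine integral_congr_ae (Eventually.of_forall fun x => ?_)
        simp only [← ofReal_realWavePacket]
        push_cast
        ring
      · simp only [packetSeries]
        rw [Complex.ofReal_tsum, tsum_mul_right]
    · refine .of_nonneg_of_le (fun n => integral_nonneg fun x => norm_nonneg _) (fun n => ?_)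
        (summable_quarter_pow.mul_right (∫ x in Set.Ioi (0 : ℝ), ‖Complex.exp (-s * x)‖))
      rw [← integral_const_mul]
      refine integral_mono (hint n).norm (hexp.norm.const_mul _) fun x => ?_
      simp only [norm_mul, Complex.norm_real]
      gcongr
      exact (abs_mul _ _).symm.trans_le (abs_packetTerm_le hX n x)

/-! ### Oscillation at the centres -/

theorem two_mul_le_of_lt {X : ℕ → ℝ} (hX : ∀ n, 1 ≤ X n) (hX2 : ∀ n, 2 * X n ≤ X (n + 1))
    {m n : ℕ} (h : m < n) : 2 * X m ≤ X n := by
  have hmono : Monotone X := monotone_nat_of_le_succ fun k => by linarith [hX k, hX2 k]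
  exact (hX2 m).trans (hmono h)

/-- At the centre of the `n`-th packet, the earlier packets have decayed and the later ones have
small amplitudes, so the `n`-th term dominates the series. -/
theorem abs_packetSeries_center_sub_le {X : ℕ → ℝ} (hX : ∀ n, 1 ≤ X n)
    (hX2 : ∀ n, 2 * X n ≤ X (n + 1))
    (hXe : ∀ n, Real.exp (-(X n / 2)) ≤ (1 / 4) ^ n / 16) (n : ℕ) :
    |packetSeries X (X n) - (-1 / 4) ^ n| ≤ (1 / 4) ^ n / 2 := by
  set f : ℕ → ℝ := fun m => (-1 / 4) ^ m * realWavePacket (m + 1) (X m) (X n) with hf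
  have hsplit : packetSeries X (X n) - (-1 / 4) ^ n
      = ∑ m ∈ Finset.range n, f m + ∑' m, f (m + (n + 1)) := by
    have h := (summable_packetTerm hX (X n)).sum_add_tsum_nat_add (n + 1)
    rw [Finset.sum_range_succ, realWavePacket_self] at h
    rw [packetSeries, ← h]
    ring
  have hlater : |∑' m, f (m + (n + 1))| ≤ (1 / 4) ^ n / 3 := by
    have h1 : HasSum (fun m : ℕ => (1 / 4 : ℝ) ^ (n + 1) * (1 / 4) ^ m)
        ((1 / 4) ^ (n + 1) * (4 / 3)) :=
      (tsum_quarter_pow ▸ summable_quarter_pow.hasSum).mul_left _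
    have h2 : ∀ m, ‖f (m + (n + 1))‖ ≤ (1 / 4) ^ (n + 1) * (1 / 4) ^ m := fun m =>
      (abs_packetTerm_le hX _ _).trans_eq (by ring)
    exact (tsum_of_norm_bounded h1 h2).trans_eq (by ring)
  have hearlier : |∑ m ∈ Finset.range n, f m| ≤ (1 / 4) ^ n / 12 := by
    have hterm : ∀ m ∈ Finset.range n, |f m| ≤ (1 / 4) ^ m * ((1 / 4) ^ n / 16) := by
      intro m hm
      rw [hf, abs_mul, abs_neg_quarter_pow]
      gcongr
      refine ((abs_realWavePacket_le _ _ _).trans (Real.exp_le_exp.2 ?_)).trans (hXe n)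
      have h2 := two_mul_le_of_lt hX hX2 (Finset.mem_range.1 hm)
      have hm1 := hX m
      have h3 : 1 / X m ≤ ((m : ℝ) + 1) / X m := by
        gcongr
        linarith [(Nat.cast_nonneg m : (0 : ℝ) ≤ m)]
      have h4 : 1 / X m * (X m * (X n / 2)) ≤ ((m : ℝ) + 1) / X m * (X n - X m) ^ 2 := by
        refine mul_le_mul h3 ?_ (by nlinarith) (by positivity)
        nlinarith [mul_nonneg (sub_nonneg.2 h2) (by linarith : 0 ≤ X n - X m / 2)]
      have h5 : 1 / X m * (X m * (X n / 2)) = X n / 2 := by field_simp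
      linarith
    calc |∑ m ∈ Finset.range n, f m| ≤ ∑ m ∈ Finset.range n, |f m| :=
          Finset.abs_sum_le_sum_abs _ _
      _ ≤ ∑ m ∈ Finset.range n, (1 / 4) ^ m * ((1 / 4) ^ n / 16) := Finset.sum_le_sum hterm
      _ = (∑ m ∈ Finset.range n, (1 / 4 : ℝ) ^ m) * ((1 / 4) ^ n / 16) := by rw [Finset.sum_mul]
      _ ≤ (4 / 3) * ((1 / 4) ^ n / 16) := by
          gcongr
          rw [← tsum_quarter_pow]
          exact summable_quarter_pow.sum_le_tsum _ fun _ _ => by positivity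
      _ = (1 / 4) ^ n / 12 := by ring
  rw [hsplit]
  have hpos : (0 : ℝ) < (1 / 4) ^ n := by positivity
  linarith [abs_add_le (∑ m ∈ Finset.range n, f m) (∑' m, f (m + (n + 1)))]

theorem isOmegaPM_packetSeries {ρ : ℝ → ℝ} {X : ℕ → ℝ} (hX : ∀ n, 1 ≤ X n)
    (hX2 : ∀ n, 2 * X n ≤ X (n + 1)) (hX_lim : Tendsto X atTop atTop)
    (hXe : ∀ n, Real.exp (-(X n / 2)) ≤ (1 / 4) ^ n / 16) (hXρ : ∀ n, ρ (X n) ≤ (1 / 4) ^ n) :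
    IsOmegaPM (packetSeries X) ρ := by
  have key := abs_packetSeries_center_sub_le hX hX2 hXe
  have hpos : ∀ n : ℕ, (0 : ℝ) < (1 / 4) ^ n := fun n => by positivity
  refine ⟨1 / 4, by norm_num, frequently_atTop.2 fun a => ?_, frequently_atTop.2 fun a => ?_⟩
  · obtain ⟨N, hN⟩ := eventually_atTop.1 (hX_lim.eventually_ge_atTop a)
    refine ⟨X (2 * N), hN _ (by omega), ?_⟩
    have h1 := (abs_le.1 (key (2 * N))).1
    have h2 : (-1 / 4 : ℝ) ^ (2 * N) = (1 / 4) ^ (2 * N) := by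
      rw [neg_div, (even_two_mul N).neg_pow]
    linarith [hXρ (2 * N), hpos (2 * N)]
  · obtain ⟨N, hN⟩ := eventually_atTop.1 (hX_lim.eventually_ge_atTop a)
    refine ⟨X (2 * N + 1), hN _ (by omega), ?_⟩
    have h1 := (abs_le.1 (key (2 * N + 1))).2
    have h2 : (-1 / 4 : ℝ) ^ (2 * N + 1) = -(1 / 4) ^ (2 * N + 1) := by
      rw [neg_div, (odd_two_mul_add_one N).neg_pow]
    linarith [hXρ (2 * N + 1), hpos (2 * N + 1)]

/-- Points at which given eventual properties hold one after the other can be chosen to grow at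
least geometrically. -/
theorem exists_lacunary_seq {p : ℕ → ℝ → Prop} (hp : ∀ n, ∀ᶠ x in atTop, p n x) :
    ∃ X : ℕ → ℝ, (∀ n, 1 ≤ X n) ∧ (∀ n, 2 * X n ≤ X (n + 1)) ∧ Tendsto X atTop atTop ∧
      ∀ n, p n (X n) := by
  choose Y hY using fun n => eventually_atTop.1 (hp n)
  set T : ℕ → ℝ := fun n => ∑ m ∈ Finset.range (n + 1), max (Y m) 1 with hT
  have hT1 : ∀ n, max (Y n) 1 ≤ T n := fun n =>
    Finset.single_le_sum (f := fun m => max (Y m) 1)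
      (fun m _ => zero_le_one.trans (le_max_right _ _)) (Finset.self_mem_range_succ n)
  have hT2 : ∀ n, T n ≤ T (n + 1) := fun n => by
    simp only [hT, Finset.sum_range_succ _ (n + 1)]
    linarith [le_max_right (Y (n + 1)) 1]
  have hle : ∀ n, T n ≤ 2 ^ n * T n := fun n =>
    le_mul_of_one_le_left (by linarith [le_max_right (Y n) 1, hT1 n]) (one_le_pow₀ one_le_two)
  refine ⟨fun n => 2 ^ n * T n, fun n => ?_, fun n => ?_, ?_, fun n => hY n _ ?_⟩
  · exact (le_max_right _ _).trans ((hT1 n).trans (hle n))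
  · simp only [pow_succ']
    nlinarith [hT2 n, pow_pos (two_pos : (0 : ℝ) < 2) n]
  · refine tendsto_atTop_mono (fun n => ?_)
      (tendsto_pow_atTop_atTop_of_one_lt (one_lt_two : (1 : ℝ) < 2))
    exact le_mul_of_one_le_right (by positivity) ((le_max_right _ _).trans (hT1 n))
  · exact (le_max_left _ _).trans ((hT1 n).trans (hle n))

/-- A bounded smooth function on the line with bounded derivative whose Laplace transform is entire
and which is `Ω_±(ρ)`. -/
theorem exists_smooth_laplace_entire_isOmegaPM {ρ : ℝ → ℝ} (hρ : Tendsto ρ atTop (𝓝 0)) :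
    ∃ τ : ℝ → ℝ, ContDiff ℝ ((⊤ : ℕ∞) : WithTop ℕ∞) τ ∧
      (∃ C, ∀ x, |τ x| ≤ C) ∧ (∃ C, ∀ x, |deriv τ x| ≤ C) ∧
      (∃ G : ℂ → ℂ, Differentiable ℂ G ∧ ∀ s : ℂ, 0 < s.re → G s = laplace τ s) ∧
      IsOmegaPM τ ρ := by
  have hev : ∀ n : ℕ, ∀ᶠ x : ℝ in atTop,
      Real.exp (-(x / 2)) ≤ (1 / 4) ^ n / 16 ∧ ρ x ≤ (1 / 4) ^ n := by
    intro n
    have hexp : Tendsto (fun x : ℝ => Real.exp (-(x / 2))) atTop (𝓝 0) :=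
      Real.tendsto_exp_neg_atTop_nhds_zero.comp (tendsto_id.atTop_div_const two_pos)
    exact (hexp.eventually_le_const (by positivity)).and (hρ.eventually_le_const (by positivity))
  obtain ⟨X, hX, hX2, hX_lim, hXp⟩ := exists_lacunary_seq hev
  exact ⟨packetSeries X, contDiff_packetSeries hX hX_lim, ⟨_, abs_packetSeries_le hX⟩,
    exists_abs_deriv_packetSeries_le hX, exists_entire_eq_laplace_packetSeries hX,
    isOmegaPM_packetSeries hX hX2 hX_lim (fun n => (hXp n).1) fun n => (hXp n).2⟩

/-! ### Laplace–Stieltjes transforms of smooth functions -/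

/-- For a monotone `C¹` function on the line, `dS = S' dx` on `(0, ∞)`, without mass at `0`. -/
theorem stieltjesMeasure_eq_withDensity {S p : ℝ → ℝ} (hS : MonotoneOn S (Set.Ici 0))
    (hd : ∀ x, HasDerivAt S (p x) x) (hp : Continuous p) (hp0 : ∀ x, 0 ≤ p x) :
    stieltjesMeasure S hS
      = (volume.restrict (Set.Ioi 0)).withDensity fun x => ENNReal.ofReal (p x) := by
  have hScont : Continuous S := continuous_iff_continuousAt.2 fun x => (hd x).continuousAt
  have hext : ∀ x, (monotone_extend hS).stieltjesFunction x = S (max x 0) := fun x => by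
    rw [Monotone.stieltjesFunction_eq]
    have hc : Continuous fun x : ℝ => S (max x 0) := by fun_prop
    exact hc.continuousAt.continuousWithinAt.rightLim_eq
  have : IsLocallyFiniteMeasure (stieltjesMeasure S hS) := by
    unfold stieltjesMeasure
    infer_instance
  refine Measure.ext_of_Ioc _ _ fun a b hab => ?_
  rw [stieltjesMeasure, StieltjesFunction.measure_Ioc, hext, hext,
    withDensity_apply _ measurableSet_Ioc, Measure.restrict_restrict measurableSet_Ioc]
  have hset : Set.Ioc a b ∩ Set.Ioi 0 = Set.Ioc (max a 0) (max b 0) := by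
    ext x
    simp only [Set.mem_inter_iff, Set.mem_Ioc, Set.mem_Ioi, max_lt_iff, le_max_iff]
    constructor
    · rintro ⟨⟨h1, h2⟩, h3⟩
      exact ⟨⟨h1, h3⟩, Or.inl h2⟩
    · rintro ⟨⟨h1, h3⟩, h2⟩
      exact ⟨⟨h1, h2.resolve_right h3.not_ge⟩, h3⟩
  have hle : max a 0 ≤ max b 0 := max_le_max_right 0 hab.le
  rw [hset, ← intervalIntegral.integral_eq_sub_of_hasDerivAt (fun x _ => hd x)
    (hp.intervalIntegrable _ _), intervalIntegral.integral_of_le hle,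
    ofReal_integral_eq_lintegral_ofReal ((hp.intervalIntegrable _ _).1)
      (Eventually.of_forall hp0)]

variable {S p : ℝ → ℝ} {C : ℝ}

theorem integrableOn_mul_exp_of_abs_le_exp {f : ℝ → ℝ} (hf : Continuous f)
    (hC : ∀ x, |f x| ≤ C * Real.exp x) {s : ℂ} (hs : 1 < s.re) :
    IntegrableOn (fun x : ℝ => (f x : ℂ) * Complex.exp (-s * x)) (Set.Ioi 0) := by
  refine ((integrableOn_exp_mul_Ioi (a := 1 - s.re) (by linarith) 0).const_mul C).mono'
    (by fun_prop) (Eventually.of_forall fun x => ?_)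
  rw [norm_mul, Complex.norm_real, Complex.norm_exp]
  calc _ ≤ C * Real.exp x * Real.exp (-s * x : ℂ).re := by
        gcongr
        exact hC x
    _ = C * Real.exp ((1 - s.re) * x) := by
        have hre : (-s * (x : ℂ)).re = -s.re * x := by simp
        rw [mul_assoc, ← Real.exp_add, hre]
        ring_nf

theorem laplaceStieltjesConverges_of_hasDerivAt (hS : MonotoneOn S (Set.Ici 0))
    (hd : ∀ x, HasDerivAt S (p x) x) (hp : Continuous p) (hp0 : ∀ x, 0 ≤ p x)
    (hpC : ∀ x, p x ≤ C * Real.exp x) {s : ℂ} (hs : 1 < s.re) :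
    LaplaceStieltjesConverges S hS s := by
  refine Integrable.integrableOn ?_
  rw [stieltjesMeasure_eq_withDensity hS hd hp hp0, integrable_withDensity_iff_integrable_smul'
    (by fun_prop) (by simp)]
  refine (integrableOn_mul_exp_of_abs_le_exp (C := C) hp (fun x => ?_) hs).congr
    (Eventually.of_forall fun x => ?_)
  · rw [abs_of_nonneg (hp0 x)]
    exact hpC x
  · simp [ENNReal.toReal_ofReal (hp0 x)]

/-- Integration by parts: the Laplace–Stieltjes transform of `S` is `s` times its Laplace transform
minus `S 0`. -/
theorem laplaceStieltjes_eq (hS : MonotoneOn S (Set.Ici 0))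
    (hd : ∀ x, HasDerivAt S (p x) x) (hp : Continuous p) (hp0 : ∀ x, 0 ≤ p x)
    (hpC : ∀ x, p x ≤ C * Real.exp x) (hSC : ∀ x, |S x| ≤ C * Real.exp x)
    {s : ℂ} (hs : 1 < s.re) :
    laplaceStieltjes S hS s = s * laplace S s - S 0 := by
  have hScont : Continuous S := continuous_iff_continuousAt.2 fun x => (hd x).continuousAt
  have hpint := integrableOn_mul_exp_of_abs_le_exp hp
    (fun x => (abs_of_nonneg (hp0 x)).trans_le (hpC x)) hs
  have hSint := integrableOn_mul_exp_of_abs_le_exp hScont hSC hs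
  have h1 : laplaceStieltjes S hS s
      = ∫ x in Set.Ioi (0 : ℝ), (p x : ℂ) * Complex.exp (-s * x) := by
    rw [laplaceStieltjes, stieltjesMeasure_eq_withDensity hS hd hp hp0,
      restrict_withDensity measurableSet_Ici, Measure.restrict_restrict measurableSet_Ici,
      Set.inter_eq_right.2 Set.Ioi_subset_Ici_self,
      integral_withDensity_eq_integral_toReal_smul (by fun_prop) (by simp)]
    refine integral_congr_ae (Eventually.of_forall fun x => ?_)
    simp [ENNReal.toReal_ofReal (hp0 x)]
  have hderiv : ∀ x : ℝ, HasDerivAt (fun x : ℝ => (S x : ℂ) * Complex.exp (-s * x))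
      ((p x : ℂ) * Complex.exp (-s * x) - s * ((S x : ℂ) * Complex.exp (-s * x))) x := by
    intro x
    have h2 : HasDerivAt (fun x : ℝ => Complex.exp (-s * x)) (Complex.exp (-s * x) * -s) x := by
      have h3 : HasDerivAt (fun x : ℝ => -s * (x : ℂ)) (-s) x := by
        simpa using (hasDerivAt_id x).ofReal_comp.const_mul (-s)
      exact h3.cexp
    exact ((hd x).ofReal_comp.mul h2).congr_deriv (by ring)
  have hlim : Tendsto (fun x : ℝ => (S x : ℂ) * Complex.exp (-s * x)) atTop (𝓝 0) := by
    refine squeeze_zero_norm (a := fun x => C * Real.exp (-((s.re - 1) * x))) (fun x => ?_) ?_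
    · rw [norm_mul, Complex.norm_real, Complex.norm_exp]
      calc _ ≤ C * Real.exp x * Real.exp (-s * x : ℂ).re := by
            gcongr
            exact hSC x
        _ = C * Real.exp (-((s.re - 1) * x)) := by
            have hre : (-s * (x : ℂ)).re = -s.re * x := by simp
            rw [mul_assoc, ← Real.exp_add, hre]
            ring_nf
    · rw [← mul_zero C]
      exact (Real.tendsto_exp_neg_atTop_nhds_zero.comp
        (tendsto_id.const_mul_atTop (by linarith : 0 < s.re - 1))).const_mul C
  have hftc := integral_Ioi_of_hasDerivAt_of_tendsto' (a := 0) (fun x _ => hderiv x)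
    (hpint.sub (hSint.const_mul s)) hlim
  rw [integral_sub hpint (hSint.const_mul s), integral_const_mul] at hftc
  rw [h1, laplace, sub_eq_iff_eq_add.1 hftc]
  simp
  ring

/-- Exponential tilting: a bounded `C¹` function `τ` with bounded derivative, scaled by a small
constant `c`, is the relative error in `S x = exp x * (1 + c * τ x)`, which is non-decreasing. -/
theorem exists_monotone_laplaceStieltjes_entire {τ ρ : ℝ → ℝ} (hτ : ContDiff ℝ 1 τ)
    {A B : ℝ} (hA : ∀ x, |τ x| ≤ A) (hB : ∀ x, |deriv τ x| ≤ B) {G : ℂ → ℂ}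
    (hG : Differentiable ℂ G) (hGτ : ∀ s : ℂ, 0 < s.re → G s = laplace τ s)
    (hΩ : IsOmegaPM τ ρ) :
    ∃ (S : ℝ → ℝ) (hS : MonotoneOn S (Set.Ici 0)),
      (∀ s : ℂ, 1 < s.re → LaplaceStieltjesConverges S hS s) ∧
      (∃ F : ℂ → ℂ, Differentiable ℂ F ∧
        ∀ s : ℂ, 1 < s.re → F s = laplaceStieltjes S hS s - 1 / (s - 1)) ∧
      IsOmegaPM (fun x => S x - Real.exp x) (fun x => ρ x * Real.exp x) := by
  have hA0 : 0 ≤ A := (abs_nonneg _).trans (hA 0)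
  have hB0 : 0 ≤ B := (abs_nonneg _).trans (hB 0)
  set c : ℝ := (1 + A + B)⁻¹ with hc
  have hc0 : 0 < c := by positivity
  have hcAB : c * (A + B) ≤ 1 := by
    rw [hc, inv_mul_le_iff₀ (by positivity)]
    linarith
  have hd : ∀ x, HasDerivAt (fun x => Real.exp x * (1 + c * τ x))
      (Real.exp x * (1 + c * (τ x + deriv τ x))) x := by
    intro x
    have h1 : HasDerivAt (fun x => 1 + c * τ x) (c * deriv τ x) x :=
      ((hτ.differentiable one_ne_zero x).hasDerivAt.const_mul c).const_add 1
    exact ((Real.hasDerivAt_exp x).mul h1).congr_deriv (by ring)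
  have hτc : Continuous τ := hτ.continuous
  have hτ' : Continuous (deriv τ) := hτ.continuous_deriv_one
  have hp : Continuous fun x => Real.exp x * (1 + c * (τ x + deriv τ x)) := by fun_prop
  have hsum : ∀ x, |c * (τ x + deriv τ x)| ≤ 1 := fun x => by
    rw [abs_mul, abs_of_pos hc0]
    refine (mul_le_mul_of_nonneg_left ((abs_add_le _ _).trans (add_le_add (hA x) (hB x)))
      hc0.le).trans hcAB
  have hp0 : ∀ x, 0 ≤ Real.exp x * (1 + c * (τ x + deriv τ x)) := fun x =>
    mul_nonneg (Real.exp_pos x).le (by linarith [(abs_le.1 (hsum x)).1])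
  have hpC : ∀ x, Real.exp x * (1 + c * (τ x + deriv τ x)) ≤ 2 * Real.exp x := fun x => by
    rw [mul_comm 2]
    gcongr
    linarith [(abs_le.1 (hsum x)).2]
  have hcτ : ∀ x, |c * τ x| ≤ 1 := fun x => by
    rw [abs_mul, abs_of_pos hc0]
    nlinarith [hA x]
  have hSC : ∀ x, |Real.exp x * (1 + c * τ x)| ≤ 2 * Real.exp x := fun x => by
    rw [abs_mul, Real.abs_exp, mul_comm 2]
    gcongr
    rw [abs_le]
    constructor <;> linarith [(abs_le.1 (hcτ x)).1, (abs_le.1 (hcτ x)).2]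
  have hS : MonotoneOn (fun x => Real.exp x * (1 + c * τ x)) (Set.Ici 0) :=
    (monotone_of_hasDerivAt_nonneg hd hp0).monotoneOn _
  refine ⟨_, hS, fun s hs => laplaceStieltjesConverges_of_hasDerivAt hS hd hp hp0 hpC hs,
    ⟨fun s => s * (c * G (s - 1)) - c * τ 0, ?_, fun s hs => ?_⟩, ?_⟩
  · exact (differentiable_id.mul ((hG.comp (differentiable_id.sub_const 1)).const_mul _)).sub_const _
  · rw [laplaceStieltjes_eq hS hd hp hp0 hpC hSC hs]
    have hs1 : 0 < (s - 1).re := by simpa using hs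
    have hne : s - 1 ≠ 0 := fun h => by simp [h] at hs1
    have hexp := integrableOn_exp_mul_complex_Ioi (a := -(s - 1)) (by simpa using hs) 0
    have hint : LaplaceConverges τ (s - 1) := laplaceConverges_of_bounded hτc hA hs1
    have hlap : laplace (fun x => Real.exp x * (1 + c * τ x)) s
        = 1 / (s - 1) + c * laplace τ (s - 1) := by
      have hadd := integral_add hexp (hint.const_mul (c : ℂ))
      rw [integral_exp_mul_complex_Ioi (by simpa using hs), integral_const_mul] at hadd
      rw [laplace, laplace]
      convert hadd using 1
      · refine integral_congr_ae (Eventually.of_forall fun x => ?_)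
        have he : Complex.exp (-(s - 1) * x) = Complex.exp x * Complex.exp (-s * x) := by
          rw [← Complex.exp_add]; ring_nf
        simp only [he]
        push_cast
        ring
      · rw [neg_div_neg_eq, Complex.ofReal_zero, mul_zero, Complex.exp_zero]
    beta_reduce
    rw [hlap, hGτ _ hs1]
    simp only [Real.exp_zero, one_mul]
    push_cast
    field_simp
    ring
  · obtain ⟨k, hk, h1, h2⟩ := hΩ
    refine ⟨c * k, by positivity, h1.mono fun x hx => ?_, h2.mono fun x hx => ?_⟩
    · have := mul_pos (mul_pos hc0 (Real.exp_pos x)) (sub_pos.2 hx)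
      linarith
    · have := mul_pos (mul_pos hc0 (Real.exp_pos x)) (sub_pos.2 hx)
      linarith

end Tauberian

theorem theorem1 (ρ : ℝ → ℝ) (hρ_pos : ∀ x : ℝ, 0 < x → 0 < ρ x)
    (hρ_lim : Filter.Tendsto ρ Filter.atTop (nhds 0)) :
    (∃ (S : ℝ → ℝ) (hS : MonotoneOn S (Set.Ici 0)),
      (∀ s : ℂ, 1 < s.re → Tauberian.LaplaceStieltjesConverges S hS s) ∧
      (∃ F : ℂ → ℂ, Differentiable ℂ F ∧
        ∀ s : ℂ, 1 < s.re → F s = Tauberian.laplaceStieltjes S hS s - 1 / (s - 1)) ∧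
      Tauberian.IsOmegaPM (fun x => S x - Real.exp x) (fun x => ρ x * Real.exp x)) ∧
    (∃ τ : ℝ → ℝ,
      ContDiffOn ℝ ((⊤ : ℕ∞) : WithTop ℕ∞) τ (Set.Ioi 0) ∧
      (∃ C : ℝ, ∀ x : ℝ, 0 < x → |deriv τ x| ≤ C) ∧
      (∀ s : ℂ, 0 < s.re → Tauberian.LaplaceConverges τ s) ∧
      (∃ G : ℂ → ℂ, Differentiable ℂ G ∧
        ∀ s : ℂ, 0 < s.re → G s = Tauberian.laplace τ s) ∧
      Tauberian.IsOmegaPM τ ρ) := by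
  obtain ⟨τ, hτ, ⟨A, hA⟩, ⟨B, hB⟩, ⟨G, hG, hGτ⟩, hΩ⟩ :=
    Tauberian.exists_smooth_laplace_entire_isOmegaPM hρ_lim
  exact ⟨Tauberian.exists_monotone_laplaceStieltjes_entire (hτ.of_le (by exact_mod_cast le_top))
      hA hB hG hGτ hΩ,
    τ, hτ.contDiffOn, ⟨B, fun x _ => hB x⟩,
    fun s hs => Tauberian.laplaceConverges_of_bounded hτ.continuous hA hs, ⟨G, hG, hGτ⟩, hΩ⟩
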